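/- For four points $x_1,\dots,x_4\in\mathbb{R}^2$ write $r_{ij}=\|x_i-x_j\|$, and call the configuration $(x_1,\dots,x_4)$ \emph{strictly planar} if the points are pairwise distinct and do not all lie on one line. For real vortex strengths $\Gamma_1,\dots,\Gamma_4$ and $\lambda'\in\mathbb{R}$ put $S_{ij}=r_{ij}^{-2}+\lambda'$ for $i\neq j$ and $S_{ii}=0$. The Albouy--Chenciner equations are \[ f_{ij}=\sum_{k=1}^{4}\Gamma_k\left[S_{ik}\left(r_{jk}^2-r_{ik}^2-r_{ij}^2\right)+S_{jk}\left(r_{ik}^2-r_{jk}^2-r_{ij}^2\right)\right]=0,\qquad 1\le i<j\le 4 . \] \textbf{Proposition.} Let $\Gamma_1=\Gamma_2=1$ and $\Gamma_3=\Gamma_4=m$ with $m<0$. Every strictly planar configuration $(x_1,\dots,x_4)$ in $\mathbb{R}^2$ that satisfies the Albouy--Chenciner equations with $\lambda'=1$ has a line of symmetry: there are a line $\ell\subset\mathbb{R}^2$ and a permutation $\tau$ of $\{1,2,3,4\}$ such that, for every $i$, the reflection in $\ell$ maps $x_i$ to $x_{\tau(i)}$ and $\Gamma_{\tau(i)}=\Gamma_i$.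 -/

import Mathlib

namespace PointVortex

/-- The plane `ℝ²` with its Euclidean metric. -/
abbrev Plane : Type := EuclideanSpace ℝ (Fin 2)

/-- `S_ij = 1 / r_ij² + λ'` for `i ≠ j`, where `r_ij = ‖x_i - x_j‖`, and `S_ii = 0`. -/
noncomputable def S {n : ℕ} (lam : ℝ) (x : Fin n → Plane) (i j : Fin n) : ℝ :=
  if i = j then 0 else 1 / dist (x i) (x j) ^ 2 + lam

/-- The left-hand side `f_ij` of the (symmetric) Albouy–Chenciner equation with indices `i, j`. -/
noncomputable def albouyChenciner {n : ℕ} (Γ : Fin n → ℝ) (lam : ℝ) (x : Fin n → Plane)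
    (i j : Fin n) : ℝ :=
  ∑ k, Γ k *
    (S lam x i k * (dist (x j) (x k) ^ 2 - dist (x i) (x k) ^ 2 - dist (x i) (x j) ^ 2) +
     S lam x j k * (dist (x i) (x k) ^ 2 - dist (x j) (x k) ^ 2 - dist (x i) (x j) ^ 2))

/-- `x` solves the Albouy–Chenciner equations with vorticities `Γ` and parameter `λ' = lam`. -/
def SolvesAlbouyChenciner {n : ℕ} (Γ : Fin n → ℝ) (lam : ℝ) (x : Fin n → Plane) : Prop :=
  ∀ i j, i < j → albouyChenciner Γ lam x i j = 0

/-- A strictly planar configuration: the vortices are at distinct points of the plane, not all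
on one line. -/
def StrictlyPlanar {n : ℕ} (x : Fin n → Plane) : Prop :=
  Function.Injective x ∧ ¬ Collinear ℝ (Set.range x)

/-- The configuration `x` of vortices with strengths `Γ` has a line of symmetry: the reflection in
some line maps the configuration to itself, each vortex going to a vortex of the same strength. -/
def HasLineOfSymmetry {n : ℕ} (Γ : Fin n → ℝ) (x : Fin n → Plane) : Prop :=
  ∃ p q : Plane, p ≠ q ∧ ∃ τ : Equiv.Perm (Fin n),
    ∀ i, Γ (τ i) = Γ i ∧ EuclideanGeometry.reflection line[ℝ, p, q] (x i) = x (τ i)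

end PointVortex

/-! Identify the plane with ℂ. The Albouy–Chenciner equations say that moving each point along its
force `F i` preserves all distances to first order. Non-collinearity then makes this motion rigid: F
i - F j = iω(z i - z j) (`exists_angular_velocity`). Since λ' = 1, conjugation gives Σ_k Γ_k/(z_k -
z_i) = v + γ conj z_i with γ = 2 + 2m - iω, the equations of a self-similar motion.

The crux is ω = 0 (`SelfSimilar.im_eq_zero`). After m = -1 is excluded, a real combination of the
equations shows that ω ≠ 0 forces Σ_{i<j} Γ_i Γ_j = 1 + 4m + m² = 0, and modulus estimates
(`reduced_collapse_false`) rule that out.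

With ω = 0 all forces agree; Σ Γ_i F_i = 0 and m ≠ -1 make them vanish. At such an equilibrium S_ij
= σ d_i d_j, where d_i is a signed area divided by Γ_i. If d₁ ≠ d₂ and d₃ ≠ d₄, then r₁₂² r₃₄² would
violate a weak Ptolemy inequality (`eq_or_eq_of_ptolemy`). Equality in either pair gives a kite. -/

open Complex ComplexConjugate

namespace PointVortex


/-! ### Modulus estimates when 1 + 4m + m² = 0 -/

/-- Three complex numbers with sum `1` satisfying the reduced collapse equations cannot exist. -/
theorem reduced_collapse_false {m : ℝ} (hm : -1 < m) (hm0 : m < 0) (hL : 1 + 4 * m + m ^ 2 = 0)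
    {γ a b c : ℂ} (hγ : 0 < γ.re) {P Q H κ : ℝ} (hP : 0 < P) (hQ : 0 < Q) (hH : 0 ≤ H)
    (habc : a + b + c = 1)
    (ha : 1 - a = (m + 4) * (1 / 2 + γ * P)) (hb : 1 - b = -m / 2 - γ * Q)
    (hc : (1 + m) * (1 - c) = -(γ * H))
    (ka : ‖a‖ * ‖1 - a‖ = κ * P) (kb : ‖b‖ * ‖1 - b‖ = κ * Q) (kc : ‖c‖ * ‖1 - c‖ = κ * H) :
    False := by
  -- The only root of the quadratic in (-1, 0) is √3 - 2 ≈ -0.268.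
  have hm1 : -0.27 < m := by nlinarith
  have hm2 : m < -0.26 := by nlinarith
  have hk : (0 : ℝ) < m + 4 := by linarith
  have hn : (0 : ℝ) < 1 + m := by linarith
  have hγ0 : γ ≠ 0 := by rintro rfl; simp at hγ
  have hsum : (1 + m) * ((m + 4) * P) = (1 + m) * Q + H := by
    have h1 : γ * ((1 + m) * ((m + 4) * P)) = γ * ((1 + m) * Q + H) := by
      linear_combination -(1 + (m : ℂ)) * ha - (1 + (m : ℂ)) * hb - hc - (1 + (m : ℂ)) * habc
    have h2 := mul_left_cancel₀ hγ0 h1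
    exact_mod_cast h2
  have hg : 0 < ‖γ‖ := norm_pos_iff.2 hγ0
  have rea : 1 - a.re = (m + 4) * (1 / 2 + γ.re * P) := by
    have := congrArg Complex.re ha
    simpa using this
  have ima : - a.im = (m + 4) * (γ.im * P) := by
    have := congrArg Complex.im ha
    simpa using this
  have sqg : ‖γ‖ ^ 2 = γ.re ^ 2 + γ.im ^ 2 := by
    rw [Complex.sq_norm, Complex.normSq_apply]; ring
  have sqa : ‖a‖ ^ 2 = a.re ^ 2 + a.im ^ 2 := by
    rw [Complex.sq_norm, Complex.normSq_apply]; ring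
  have sqa1 : ‖1 - a‖ ^ 2 = (1 - a.re) ^ 2 + a.im ^ 2 := by
    rw [Complex.sq_norm, Complex.normSq_apply]; simp; ring
  have hxP : 0 < (m + 4) * (γ.re * P) := by positivity
  have ima' : a.im = -((m + 4) * (γ.im * P)) := by linarith
  -- As (m + 4)/2 > 1, both -Re a and Re (1 - a) exceed (m + 4) Re γ P.
  have hna : (m + 4) * ‖γ‖ * P ≤ ‖a‖ := by
    refine (sq_le_sq₀ (by positivity) (norm_nonneg _)).1 ?_
    have : ((m + 4) * ‖γ‖ * P) ^ 2 = ((m + 4) * (γ.re * P)) ^ 2 + a.im ^ 2 := by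
      rw [ima', mul_pow, mul_pow, sqg]; ring
    rw [this, sqa]
    have h : (m + 4) * (γ.re * P) ≤ -a.re := by linarith
    have := pow_le_pow_left₀ hxP.le h 2
    linarith
  have hna1 : (m + 4) * ‖γ‖ * P ≤ ‖1 - a‖ := by
    refine (sq_le_sq₀ (by positivity) (norm_nonneg _)).1 ?_
    have : ((m + 4) * ‖γ‖ * P) ^ 2 = ((m + 4) * (γ.re * P)) ^ 2 + a.im ^ 2 := by
      rw [ima', mul_pow, mul_pow, sqg]; ring
    rw [this, sqa1]
    have h : (m + 4) * (γ.re * P) ≤ 1 - a.re := by linarith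
    have := pow_le_pow_left₀ hxP.le h 2
    linarith
  have hna2 : (m + 4) / 2 ≤ ‖1 - a‖ := by
    have := Complex.re_le_norm (1 - a)
    simp only [Complex.sub_re, Complex.one_re] at this
    linarith
  rcases hH.eq_or_lt with h0 | hHpos
  -- Here ‖1 + a‖ = (m + 4)‖1 - a‖, whereas Re a < 0 gives ‖1 + a‖ ≤ ‖1 - a‖.
  · subst h0
    have hc1 : c = 1 := by
      have : (1 + (m : ℂ)) ≠ 0 := by exact_mod_cast hn.ne'
      have h3 : (1 + (m : ℂ)) * (1 - c) = 0 := by rw [hc]; simp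
      rcases mul_eq_zero.1 h3 with h | h
      · exact absurd h this
      · linear_combination -h
    have hba : b = -a := by linear_combination habc - hc1
    have hQ' : Q = (m + 4) * P := by
      apply mul_left_cancel₀ hn.ne'; linarith
    have h1 : ‖a‖ * ‖1 + a‖ = ‖a‖ * ((m + 4) * ‖1 - a‖) := by
      rw [hba, norm_neg, sub_neg_eq_add, hQ'] at kb
      rw [kb]; linear_combination -(m + 4) * ka
    have hapos : 0 < ‖a‖ := lt_of_lt_of_le (by positivity) hna
    have h2 := mul_left_cancel₀ hapos.ne' h1
    have h3 : ‖1 + a‖ ≤ ‖1 - a‖ := by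
      refine (sq_le_sq₀ (by positivity) (norm_nonneg _)).1 ?_
      rw [sqa1, Complex.sq_norm, Complex.normSq_apply]
      simp only [Complex.add_re, Complex.one_re, Complex.add_im, Complex.one_im]
      linarith
    have h4 : 0 < (m + 3) * ‖1 - a‖ := mul_pos (by linarith) (by linarith)
    linarith
  -- For H > 0, `kc` and `hc` determine ‖c‖, and ‖c‖ ≤ 1 + ‖1 - c‖ bounds κ above. The lower bound
  -- `hκ2` is incompatible with this because (m + 2)(m + 4) = 2m + 7 > 2.
  · have hκ1 : (m + 4) ^ 2 * ‖γ‖ ^ 2 * P ≤ κ := by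
      have := mul_le_mul hna hna1 (by positivity) (norm_nonneg _)
      rw [ka] at this
      exact le_of_mul_le_mul_right (by linarith) hP
    have hκ2 : (m + 4) ^ 2 * ‖γ‖ / 2 ≤ κ := by
      have := mul_le_mul hna hna2 (by positivity) (norm_nonneg _)
      rw [ka] at this
      exact le_of_mul_le_mul_right (by linarith) hP
    have hHP : H ≤ (1 + m) * ((m + 4) * P) := by linarith [mul_pos hn hQ]
    have hc' : (1 + m) * ‖1 - c‖ = ‖γ‖ * H := by
      have := congrArg norm hc
      rw [norm_mul, norm_neg, norm_mul, Complex.norm_real, Real.norm_of_nonneg hH] at this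
      rw [← this]
      congr 1
      rw [show (1 + (m : ℂ)) = ((1 + m : ℝ) : ℂ) by push_cast; rfl, Complex.norm_real,
        Real.norm_of_nonneg hn.le]
    have hcκ : ‖c‖ * ‖γ‖ = (1 + m) * κ := by
      apply mul_right_cancel₀ hHpos.ne'
      linear_combination (1 + m) * kc - ‖c‖ * hc'
    have hcle : ‖c‖ ≤ 1 + ‖1 - c‖ := by
      calc ‖c‖ = ‖1 - (1 - c)‖ := by ring_nf
        _ ≤ ‖(1 : ℂ)‖ + ‖1 - c‖ := norm_sub_le _ _
        _ = 1 + ‖1 - c‖ := by simp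
    -- combine the estimates into a linear bound for `κ` in terms of `‖γ‖`
    have e1 : (1 + m) ^ 2 * κ ≤ (1 + m) * ‖γ‖ + ‖γ‖ ^ 2 * H := by
      have := mul_le_mul_of_nonneg_right hcle (mul_pos hn hg).le
      linear_combination this - (1 + m) * hcκ + ‖γ‖ * hc'
    have e2 : (m + 4) * (‖γ‖ ^ 2 * H) ≤ (1 + m) * κ := by
      have h1 := mul_le_mul_of_nonneg_left hHP (by positivity : 0 ≤ (m + 4) * ‖γ‖ ^ 2)
      have h2 := mul_le_mul_of_nonneg_left hκ1 hn.le
      linear_combination h1 + h2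
    have e3 : ((m + 4) * (1 + m) - 1) * κ ≤ (m + 4) * ‖γ‖ := by
      have := mul_le_mul_of_nonneg_left e1 hk.le
      have h5 : (1 + m) * (((m + 4) * (1 + m) - 1) * κ) ≤ (1 + m) * ((m + 4) * ‖γ‖) := by
        linear_combination this + e2
      exact le_of_mul_le_mul_left h5 hn
    have f1 : (m + 4) * (1 + m) - 1 = m + 2 := by linear_combination hL
    rw [f1] at e3
    have f2 := mul_le_mul_of_nonneg_left hκ2 (by linarith : 0 ≤ m + 2)
    have f3 : (m + 2) * ((m + 4) ^ 2 * ‖γ‖ / 2) = (m + 4) * ‖γ‖ * (2 * m + 7) / 2 := by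
      linear_combination (m + 4) * ‖γ‖ / 2 * hL
    have f4 : 0 < (m + 4) * ‖γ‖ * (2 * m + 5) := mul_pos (mul_pos hk hg) (by linarith)
    linarith

/-! ### Self-similar motions in half-diagonal coordinates -/

/-- The equations for a self-similar motion of the vortices `1, 1, m, m`, in terms of the half
diagonals `p`, `q` and the difference `h` of the midpoints of the two pairs. -/
theorem reduced_equations {m : ℝ} {o p q h v γ : ℂ} (hp : p ≠ 0) (hq : q ≠ 0)
    (h1 : h + p - q ≠ 0) (h2 : h + p + q ≠ 0) (h3 : h - p - q ≠ 0) (h4 : h - p + q ≠ 0)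
    (e1 : 1 / ((o + h - p) - (o + h + p)) + m / ((o + q) - (o + h + p))
      + m / ((o - q) - (o + h + p)) = v + γ * conj (o + h + p))
    (e2 : 1 / ((o + h + p) - (o + h - p)) + m / ((o + q) - (o + h - p))
      + m / ((o - q) - (o + h - p)) = v + γ * conj (o + h - p))
    (e3 : m / ((o - q) - (o + q)) + 1 / ((o + h + p) - (o + q))
      + 1 / ((o + h - p) - (o + q)) = v + γ * conj (o + q))
    (e4 : m / ((o + q) - (o - q)) + 1 / ((o + h + p) - (o - q))
      + 1 / ((o + h - p) - (o - q)) = v + γ * conj (o - q))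
    {R : ℂ} (hR : R = (h + p - q) * (h + p + q) * (h - p - q) * (h - p + q)) :
    γ * normSq p * R = -R / 2 + 2 * m * p ^ 2 * (h ^ 2 - p ^ 2 + q ^ 2) ∧
    γ * normSq q * R = -m * R / 2 + 2 * q ^ 2 * (h ^ 2 + p ^ 2 - q ^ 2) ∧
    γ * normSq h * R = -2 * (1 + m) * h ^ 2 * (h ^ 2 - p ^ 2 - q ^ 2) := by
  have n1 : (o + h - p) - (o + h + p) = -(2 * p) := by ring
  have n2 : (o + h + p) - (o + h - p) = 2 * p := by ring
  have n3 : (o - q) - (o + q) = -(2 * q) := by ring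
  have n4 : (o + q) - (o - q) = 2 * q := by ring
  have n5 : (o + q) - (o + h + p) = -(h + p - q) := by ring
  have n6 : (o - q) - (o + h + p) = -(h + p + q) := by ring
  have n7 : (o + q) - (o + h - p) = -(h - p - q) := by ring
  have n8 : (o - q) - (o + h - p) = -(h - p + q) := by ring
  have n9 : (o + h + p) - (o + q) = h + p - q := by ring
  have n10 : (o + h + p) - (o - q) = h + p + q := by ring
  have n11 : (o + h - p) - (o + q) = h - p - q := by ring
  have n12 : (o + h - p) - (o - q) = h - p + q := by ring
  rw [n1, n5, n6] at e1
  rw [n2, n7, n8] at e2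
  rw [n3, n9, n11] at e3
  rw [n4, n10, n12] at e4
  simp only [map_add, map_sub] at e1 e2 e3 e4
  rw [Complex.normSq_eq_conj_mul_self, Complex.normSq_eq_conj_mul_self,
    Complex.normSq_eq_conj_mul_self]
  -- Half differences within a pair, and the difference of the two pair means, eliminate o and v.
  have k1 : γ * conj p = (1 / -(2 * p) + m / -(h + p - q) + m / -(h + p + q)
      - (1 / (2 * p) + m / -(h - p - q) + m / -(h - p + q))) / 2 := by
    linear_combination (e2 - e1) / 2
  have k2 : γ * conj q = (m / -(2 * q) + 1 / (h + p - q) + 1 / (h - p - q)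
      - (m / (2 * q) + 1 / (h + p + q) + 1 / (h - p + q))) / 2 := by
    linear_combination (e4 - e3) / 2
  have k3 : γ * conj h = (1 / -(2 * p) + m / -(h + p - q) + m / -(h + p + q)
      + (1 / (2 * p) + m / -(h - p - q) + m / -(h - p + q))
      - (m / -(2 * q) + 1 / (h + p - q) + 1 / (h - p - q))
      - (m / (2 * q) + 1 / (h + p + q) + 1 / (h - p + q))) / 2 := by
    linear_combination (-e1 - e2 + e3 + e4) / 2
  refine ⟨?_, ?_, ?_⟩
  · rw [show γ * (conj p * p) * R = (γ * conj p) * p * R by ring, k1, hR]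
    field_simp
    ring
  · rw [show γ * (conj q * q) * R = (γ * conj q) * q * R by ring, k2, hR]
    field_simp
    ring
  · rw [show γ * (conj h * h) * R = (γ * conj h) * h * R by ring, k3, hR]
    field_simp
    ring


/-- The vortices `1, 1, m, m` at `z₁, …, z₄` have the conjugate velocities `v + γ * conj zᵢ`. -/
def SelfSimilar (m : ℝ) (z₁ z₂ z₃ z₄ v γ : ℂ) : Prop :=
  1 / (z₂ - z₁) + m / (z₃ - z₁) + m / (z₄ - z₁) = v + γ * conj z₁ ∧
  1 / (z₁ - z₂) + m / (z₃ - z₂) + m / (z₄ - z₂) = v + γ * conj z₂ ∧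
  m / (z₄ - z₃) + 1 / (z₁ - z₃) + 1 / (z₂ - z₃) = v + γ * conj z₃ ∧
  m / (z₃ - z₄) + 1 / (z₁ - z₄) + 1 / (z₂ - z₄) = v + γ * conj z₄

/-- Interchanging the two pairs of vortices and rescaling the strengths. -/
theorem SelfSimilar.swap {m : ℝ} (hm : m ≠ 0) {z₁ z₂ z₃ z₄ v γ : ℂ}
    (h : SelfSimilar m z₁ z₂ z₃ z₄ v γ) :
    SelfSimilar m⁻¹ z₃ z₄ z₁ z₂ ((m⁻¹ : ℝ) * v) ((m⁻¹ : ℝ) * γ) := by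
  have hm' : (m : ℂ) ≠ 0 := by exact_mod_cast hm
  have hi : (m : ℂ)⁻¹ * m = 1 := inv_mul_cancel₀ hm'
  obtain ⟨h1, h2, h3, h4⟩ := h
  simp only [div_eq_mul_inv, one_mul] at h1 h2 h3 h4
  refine ⟨?_, ?_, ?_, ?_⟩ <;> push_cast <;> simp only [div_eq_mul_inv, one_mul]
  · linear_combination (m : ℂ)⁻¹ * h3 - (z₄ - z₃)⁻¹ * hi
  · linear_combination (m : ℂ)⁻¹ * h4 - (z₃ - z₄)⁻¹ * hi
  · linear_combination (m : ℂ)⁻¹ * h1 - ((z₃ - z₁)⁻¹ + (z₄ - z₁)⁻¹) * hi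
  · linear_combination (m : ℂ)⁻¹ * h2 - ((z₃ - z₂)⁻¹ + (z₄ - z₂)⁻¹) * hi

theorem SelfSimilar.exists_reduced {m : ℝ} {z₁ z₂ z₃ z₄ v γ : ℂ}
    (h : SelfSimilar m z₁ z₂ z₃ z₄ v γ) (h12 : z₁ ≠ z₂) (h13 : z₁ ≠ z₃) (h14 : z₁ ≠ z₄)
    (h23 : z₂ ≠ z₃) (h24 : z₂ ≠ z₄) (h34 : z₃ ≠ z₄) :
    ∃ p q h R : ℂ, p ≠ 0 ∧ q ≠ 0 ∧ R ≠ 0 ∧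
      R = (h + p - q) * (h + p + q) * (h - p - q) * (h - p + q) ∧
      γ * normSq p * R = -R / 2 + 2 * m * p ^ 2 * (h ^ 2 - p ^ 2 + q ^ 2) ∧
      γ * normSq q * R = -m * R / 2 + 2 * q ^ 2 * (h ^ 2 + p ^ 2 - q ^ 2) ∧
      γ * normSq h * R = -2 * (1 + m) * h ^ 2 * (h ^ 2 - p ^ 2 - q ^ 2) := by
  obtain ⟨o, p, q, k, rfl, rfl, rfl, rfl⟩ : ∃ o p q k : ℂ,
      z₁ = o + k + p ∧ z₂ = o + k - p ∧ z₃ = o + q ∧ z₄ = o - q :=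
    ⟨(z₃ + z₄) / 2, (z₁ - z₂) / 2, (z₃ - z₄) / 2, (z₁ + z₂) / 2 - (z₃ + z₄) / 2,
      by ring, by ring, by ring, by ring⟩
  obtain ⟨e1, e2, e3, e4⟩ := h
  have hp : p ≠ 0 := by rintro rfl; simp at h12
  have hq : q ≠ 0 := by rintro rfl; simp at h34
  have n1 : k + p - q ≠ 0 := fun h0 => h13 (by linear_combination h0)
  have n2 : k + p + q ≠ 0 := fun h0 => h14 (by linear_combination h0)
  have n3 : k - p - q ≠ 0 := fun h0 => h23 (by linear_combination h0)
  have n4 : k - p + q ≠ 0 := fun h0 => h24 (by linear_combination h0)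
  exact ⟨p, q, k, _, hp, hq, by simp only [ne_eq, mul_eq_zero]; tauto, rfl,
    reduced_equations hp hq n1 n2 n3 n4 e1 e2 e3 e4 rfl⟩

/-- R is -16 times the squared area of a formal triangle with complex squared sides p², q², h². The
numbers a, b, c are the products of two of its cotangents, so a + b + c = 1, and each ‖a‖‖1 - a‖ is
the modulus of its squared side times a symmetric factor κ. The hypothesis `hL` enters as -1/m = m +
4. -/
theorem SelfSimilar.false_of_re_pos {m : ℝ} {z₁ z₂ z₃ z₄ v γ : ℂ}
    (h : SelfSimilar m z₁ z₂ z₃ z₄ v γ) (h12 : z₁ ≠ z₂) (h13 : z₁ ≠ z₃) (h14 : z₁ ≠ z₄)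
    (h23 : z₂ ≠ z₃) (h24 : z₂ ≠ z₄) (h34 : z₃ ≠ z₄)
    (hm : -1 < m) (hm0 : m < 0) (hL : 1 + 4 * m + m ^ 2 = 0) (hγ : 0 < γ.re) : False := by
  obtain ⟨p, q, h, R, hp, hq, hR0, hR, e1, e2, e3⟩ := h.exists_reduced h12 h13 h14 h23 h24 h34
  have hLC : (1 + 4 * m + m ^ 2 : ℂ) = 0 := by exact_mod_cast hL
  have one_sub : ∀ P Q H : ℂ, R = P ^ 2 + Q ^ 2 + H ^ 2 - 2 * P * Q - 2 * P * H - 2 * Q * H →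
      1 - -((P + H - Q) * (P + Q - H)) / R = -2 * P * (Q + H - P) / R := by
    intro P Q H h0
    field_simp
    linear_combination h0
  have norm_eq : ∀ P Q H : ℂ, R = P ^ 2 + Q ^ 2 + H ^ 2 - 2 * P * Q - 2 * P * H - 2 * Q * H →
      ‖-((P + H - Q) * (P + Q - H)) / R‖ * ‖1 - -((P + H - Q) * (P + Q - H)) / R‖
        = ‖2 * (P + H - Q) * (P + Q - H) * (Q + H - P) / R ^ 2‖ * ‖P‖ := by
    intro P Q H h0
    rw [one_sub P Q H h0, ← norm_mul, ← norm_mul]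
    congr 1
    field_simp
  have hRP : R = (p ^ 2) ^ 2 + (q ^ 2) ^ 2 + (h ^ 2) ^ 2 - 2 * p ^ 2 * q ^ 2 - 2 * p ^ 2 * h ^ 2
      - 2 * q ^ 2 * h ^ 2 := by rw [hR]; ring
  have nsq : ∀ w : ℂ, ‖w ^ 2‖ = normSq w := by
    intro w; rw [norm_pow, Complex.sq_norm]
  refine reduced_collapse_false hm hm0 hL hγ
    (a := -((p ^ 2 + h ^ 2 - q ^ 2) * (p ^ 2 + q ^ 2 - h ^ 2)) / R)
    (b := -((q ^ 2 + h ^ 2 - p ^ 2) * (q ^ 2 + p ^ 2 - h ^ 2)) / R)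
    (c := -((h ^ 2 + q ^ 2 - p ^ 2) * (h ^ 2 + p ^ 2 - q ^ 2)) / R)
    (P := normSq p) (Q := normSq q) (H := normSq h)
    (κ := ‖2 * (p ^ 2 + h ^ 2 - q ^ 2) * (p ^ 2 + q ^ 2 - h ^ 2) * (q ^ 2 + h ^ 2 - p ^ 2) / R ^ 2‖)
    (normSq_pos.2 hp) (normSq_pos.2 hq) (normSq_nonneg h) ?_ ?_ ?_ ?_ ?_ ?_ ?_
  · field_simp
    linear_combination -hRP
  · rw [one_sub _ _ _ (by linear_combination hRP)]
    field_simp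
    linear_combination -2 * (m + 4) * e1 - 4 * p ^ 2 * (q ^ 2 + h ^ 2 - p ^ 2) * hLC
  · rw [one_sub _ _ _ (by linear_combination hRP)]
    field_simp
    linear_combination 2 * e2
  · rw [one_sub _ _ _ (by linear_combination hRP)]
    field_simp
    linear_combination e3
  · rw [norm_eq _ _ _ (by linear_combination hRP), nsq]
  · rw [norm_eq _ _ _ (by linear_combination hRP), nsq]
    congr 2; ring
  · rw [norm_eq _ _ _ (by linear_combination hRP), nsq]
    congr 2; ring

/-- A self-similar motion of the vortices `1, 1, m, m` with expansion rate `2 + 2 * m` has no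
rotational part, and `m ≠ -1`. -/
theorem SelfSimilar.im_eq_zero {m : ℝ} {z₁ z₂ z₃ z₄ v γ : ℂ}
    (h : SelfSimilar m z₁ z₂ z₃ z₄ v γ) (h12 : z₁ ≠ z₂) (h13 : z₁ ≠ z₃) (h14 : z₁ ≠ z₄)
    (h23 : z₂ ≠ z₃) (h24 : z₂ ≠ z₄) (h34 : z₃ ≠ z₄)
    (hm0 : m < 0) (hγ : γ.re = 2 + 2 * m) : γ.im = 0 ∧ m ≠ -1 := by
  obtain ⟨p, q, k, R, hp, hq, hR0, hR, e1, e2, e3⟩ := h.exists_reduced h12 h13 h14 h23 h24 h34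
  -- For m = -1, Re γ = 0 and `e3` leaves two cases: γ = 0 forces R = 0 or pq = 0, and k = 0 forces
  -- γ(|p|² - |q|²) = 1, whose real part is 0 = 1.
  have hm1 : m ≠ -1 := by
    rintro rfl
    have hre : γ.re = 0 := by linarith
    push_cast at e1 e2 e3
    have h3 : γ * normSq k * R = 0 := by rw [e3]; ring
    have hk : γ = 0 ∨ k = 0 := by simpa [hR0] using h3
    rcases hk with h0 | h0
    · subst h0
      have h5 : (q ^ 2 - p ^ 2) * (k ^ 2 - p ^ 2 - q ^ 2) = 0 := by
        linear_combination -(e1 + e2) / 2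
      rcases mul_eq_zero.1 h5 with h6 | h6
      · have h7 : (k ^ 2) ^ 2 = 0 := by
          linear_combination -hR + 2 * e1 + (2 * k ^ 2 - 4 * p ^ 2 - (q ^ 2 - p ^ 2)) * h6
        have h8 : k ^ 2 = 0 := pow_eq_zero_iff two_ne_zero |>.1 h7
        exact hR0 (by linear_combination 2 * e1 - 4 * p ^ 2 * h6 - 4 * p ^ 2 * h8)
      · have h7 : p ^ 2 * q ^ 2 = 0 := by
          linear_combination (-hR + 2 * e1 - (k ^ 2 + 3 * p ^ 2 - q ^ 2) * h6) / 4
        simp [hp, hq] at h7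
    · subst h0
      have h5 : γ * (normSq p - normSq q) = 1 := by
        apply mul_right_cancel₀ hR0
        linear_combination e1 - e2 - 2 * hR
      have := congrArg Complex.re h5
      rw [show (normSq p - normSq q : ℂ) = ((normSq p - normSq q : ℝ) : ℂ) by push_cast; rfl,
        Complex.re_mul_ofReal, hre] at this
      simp at this
  refine ⟨?_, hm1⟩
  by_contra him
  -- With weights 1 + m, m(1 + m), m the right-hand sides add up to a real multiple of R. If Im γ ≠
  -- 0, the real factor of γ is zero, hence so is the right side.
  have hX : γ * (((1 + m) * (normSq p + m * normSq q) + m * normSq k : ℝ) : ℂ)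
      = ((-(1 + m) * (1 + 4 * m + m ^ 2) / 2 : ℝ) : ℂ) := by
    apply mul_right_cancel₀ hR0
    push_cast
    linear_combination (1 + m) * e1 + (1 + m) * m * e2 + m * e3 + 2 * (1 + m) * m * hR
  have him' := congrArg Complex.im hX
  have hre' := congrArg Complex.re hX
  rw [Complex.im_mul_ofReal, Complex.ofReal_im] at him'
  rw [Complex.re_mul_ofReal, Complex.ofReal_re] at hre'
  rw [(mul_eq_zero.1 him').resolve_left him, mul_zero] at hre'
  have hM : 1 + m ≠ 0 := fun h0 => hm1 (by linarith)
  have hL : 1 + 4 * m + m ^ 2 = 0 := by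
    apply mul_left_cancel₀ hM
    linarith
  -- The roots of the quadratic are mutually inverse, so for m < -1 the pairs are exchanged; the new
  -- rate m⁻¹(2 + 2m) is again positive.
  rcases lt_or_gt_of_ne hm1 with hlt | hgt
  · have hmi : m⁻¹ * m = 1 := inv_mul_cancel₀ hm0.ne
    have hi0 : m⁻¹ < 0 := inv_lt_zero.2 hm0
    have hi : m⁻¹ = -m - 4 := by
      apply mul_right_cancel₀ hm0.ne
      linear_combination hmi + hL
    have hi1 : -1 < m⁻¹ := by rw [hi]; nlinarith
    refine (h.swap hm0.ne).false_of_re_pos h34 h13.symm h23.symm h14.symm h24.symm h12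
      hi1 hi0 ?_ ?_
    · rw [hi]; linear_combination hL
    · rw [Complex.re_ofReal_mul, hγ]
      linarith
  · exact h.false_of_re_pos h12 h13 h14 h23 h24 h34 hgt hm0 hL (by rw [hγ]; linarith)


/-! ### Infinitesimal rigidity in the plane -/

/-- A vector of the plane orthogonal to two independent vectors is zero. -/
theorem eq_zero_of_re_mul_conj_eq_zero {w u v : ℂ} (hu : (w * conj u).re = 0)
    (hv : (w * conj v).re = 0) (huv : u.re * v.im - u.im * v.re ≠ 0) : w = 0 := by
  simp only [Complex.mul_re, Complex.conj_re, Complex.conj_im] at hu hv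
  apply Complex.ext
  · apply mul_right_cancel₀ huv
    rw [Complex.zero_re]
    linear_combination v.im * hu - u.im * hv
  · apply mul_right_cancel₀ huv
    rw [Complex.zero_im]
    linear_combination u.re * hv - v.re * hu

/-- An infinitesimal deformation of a noncollinear set of points in the plane that preserves all
distances to first order is a rigid motion. -/
theorem exists_angular_velocity {ι : Type*} {z F : ι → ℂ}
    (hF : ∀ i j, ((F i - F j) * conj (z i - z j)).re = 0) {a b c : ι}
    (habc : (z b - z a).re * (z c - z a).im - (z b - z a).im * (z c - z a).re ≠ 0) :
    ∃ ω : ℝ, ∀ i j, F i - F j = I * ω * (z i - z j) := by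
  have hab : z b - z a ≠ 0 := by
    intro h
    simp [h] at habc
  set N := normSq (z b - z a) with hN
  have hN0 : N ≠ 0 := by rwa [hN, ne_eq, normSq_eq_zero]
  -- This ω is the rotation rate of the edge from a to b; subtracting that rotation gives G b = G a.
  set ω := ((F b - F a) * conj (z b - z a)).im / N with hω
  set G : ι → ℂ := fun i => F i - I * ω * z i with hGdef
  have hG : ∀ i j, ((G i - G j) * conj (z i - z j)).re = 0 := by
    intro i j
    have h := hF i j
    have : (G i - G j) * conj (z i - z j)
        = (F i - F j) * conj (z i - z j) - I * (ω * normSq (z i - z j) : ℝ) := by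
      push_cast
      rw [Complex.normSq_eq_conj_mul_self]
      simp only [hGdef]
      ring
    rw [this, Complex.sub_re, h, Complex.re_mul_ofReal, Complex.I_re]
    simp
  have hGba : G b = G a := by
    have h1 : (G b - G a) * conj (z b - z a) = 0 := by
      apply Complex.ext
      · exact hG b a
      · have : (G b - G a) * conj (z b - z a)
          = (F b - F a) * conj (z b - z a) - I * (ω * N : ℝ) := by
          push_cast
          rw [hN, Complex.normSq_eq_conj_mul_self]
          simp only [hGdef]
          ring
        rw [this, Complex.sub_im, Complex.im_mul_ofReal, Complex.I_im, one_mul,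
          hω, div_mul_cancel₀ _ hN0]
        simp
    rcases mul_eq_zero.1 h1 with h2 | h2
    · exact sub_eq_zero.1 h2
    · exact absurd ((map_eq_zero _).1 h2) hab
  have sub_perp : ∀ i p q : ι, G p = G q → ((G i - G p) * conj (z q - z p)).re = 0 := by
    intro i p q hpq
    have h1 := hG i p
    have h2 := hG i q
    rw [← hpq] at h2
    rw [show (G i - G p) * conj (z q - z p)
      = (G i - G p) * conj (z i - z p) - (G i - G p) * conj (z i - z q) by
        simp only [map_sub]; ring, Complex.sub_re, h1, h2, sub_zero]
  have hGca : G c = G a := by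
    apply sub_eq_zero.1
    exact eq_zero_of_re_mul_conj_eq_zero (sub_perp c a b hGba.symm) (hG c a) habc
  have hGa : ∀ i, G i = G a := fun i => sub_eq_zero.1 <|
    eq_zero_of_re_mul_conj_eq_zero (sub_perp i a b hGba.symm) (sub_perp i a c hGca.symm) habc
  refine ⟨ω, fun i j => ?_⟩
  have h := (hGa i).trans (hGa j).symm
  simp only [hGdef] at h
  linear_combination h

/-! ### Equilibria with positive S_ij are kites -/

/-- The algebraic core of the symmetry argument for relative equilibria. -/
theorem eq_or_eq_of_ptolemy {m σ d₁ d₂ d₃ d₄ s₁₂ s₁₃ s₁₄ s₂₃ s₂₄ s₃₄ : ℝ} (hm : m ≠ 0)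
    (p₁₃ : 0 < s₁₃) (p₁₄ : 0 < s₁₄) (p₂₃ : 0 < s₂₃) (p₂₄ : 0 < s₂₄)
    (e₁₃ : 1 / s₁₃ + 1 = σ * (d₁ * d₃)) (e₁₄ : 1 / s₁₄ + 1 = σ * (d₁ * d₄))
    (e₂₃ : 1 / s₂₃ + 1 = σ * (d₂ * d₃)) (e₂₄ : 1 / s₂₄ + 1 = σ * (d₂ * d₄))
    (h₁₂ : (d₂ - d₁) * s₁₂ + m * d₃ * (s₁₃ - s₂₃) + m * d₄ * (s₁₄ - s₂₄) = 0)
    (h₃₄ : m * (d₄ - d₃) * s₃₄ + d₁ * (s₁₃ - s₁₄) + d₂ * (s₂₃ - s₂₄) = 0)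
    (hP : s₁₂ * s₃₄ ≤ 2 * (s₁₃ * s₂₄ + s₁₄ * s₂₃)) : d₁ = d₂ ∨ d₃ = d₄ := by
  by_contra! hne
  have f₁₃ : σ * (d₁ * d₃) * s₁₃ = 1 + s₁₃ := by rw [← e₁₃]; field_simp
  have f₁₄ : σ * (d₁ * d₄) * s₁₄ = 1 + s₁₄ := by rw [← e₁₄]; field_simp
  have f₂₃ : σ * (d₂ * d₃) * s₂₃ = 1 + s₂₃ := by rw [← e₂₃]; field_simp
  have f₂₄ : σ * (d₂ * d₄) * s₂₄ = 1 + s₂₄ := by rw [← e₂₄]; field_simp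
  -- Substituting the `f` relations into `h₁₂` makes it divisible by d₂ - d₁; likewise `h₃₄` by d₄ -
  -- d₃. In the product of the two quotients σ and the d_i occur only through σ d_i d_j s_ij = 1 +
  -- s_ij.
  have g₁₂ : s₁₂ = -m * σ * (d₃ ^ 2 * (s₁₃ * s₂₃) + d₄ ^ 2 * (s₁₄ * s₂₄)) := by
    apply mul_left_cancel₀ (sub_ne_zero.2 hne.1.symm)
    linear_combination h₁₂ + m * d₃ * (s₁₃ * f₂₃ - s₂₃ * f₁₃) + m * d₄ * (s₁₄ * f₂₄ - s₂₄ * f₁₄)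
  have g₃₄ : m * s₃₄ = -σ * (d₁ ^ 2 * (s₁₃ * s₁₄) + d₂ ^ 2 * (s₂₃ * s₂₄)) := by
    apply mul_left_cancel₀ (sub_ne_zero.2 hne.2.symm)
    linear_combination h₃₄ + d₁ * (s₁₃ * f₁₄ - s₁₄ * f₁₃) + d₂ * (s₂₃ * f₂₄ - s₂₄ * f₂₃)
  have key : s₁₂ * s₃₄ = s₁₄ * s₂₃ * ((1 + s₁₃) ^ 2 + (1 + s₂₄) ^ 2)
      + s₁₃ * s₂₄ * ((1 + s₁₄) ^ 2 + (1 + s₂₃) ^ 2) := by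
    rw [← f₁₃, ← f₁₄, ← f₂₃, ← f₂₄]
    apply mul_left_cancel₀ hm
    rw [g₁₂]
    linear_combination -m * σ * (d₃ ^ 2 * (s₁₃ * s₂₃) + d₄ ^ 2 * (s₁₄ * s₂₄)) * g₃₄
  have k1 : s₁₄ * s₂₃ * 2 < s₁₄ * s₂₃ * ((1 + s₁₃) ^ 2 + (1 + s₂₄) ^ 2) :=
    mul_lt_mul_of_pos_left (by linarith [sq_nonneg s₁₃, sq_nonneg s₂₄]) (by positivity)
  have k2 : s₁₃ * s₂₄ * 2 < s₁₃ * s₂₄ * ((1 + s₁₄) ^ 2 + (1 + s₂₃) ^ 2) :=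
    mul_lt_mul_of_pos_left (by linarith [sq_nonneg s₁₄, sq_nonneg s₂₃]) (by positivity)
  linarith

/-- A weak form of Ptolemy's inequality. -/
theorem normSq_mul_normSq_le (a b c d : ℂ) : normSq (a - b) * normSq (c - d)
    ≤ 2 * (normSq (a - c) * normSq (b - d) + normSq (a - d) * normSq (b - c)) := by
  rw [← normSq_mul, ← normSq_mul, ← normSq_mul,
    show (a - b) * (c - d) = (a - d) * (b - c) * (-1) + (a - c) * (b - d) by ring]
  generalize (a - d) * (b - c) = u
  generalize (a - c) * (b - d) = w
  simp only [normSq_apply, Complex.add_re, Complex.add_im, mul_neg, mul_one, Complex.neg_re,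
    Complex.neg_im]
  linarith [sq_nonneg (u.re + w.re), sq_nonneg (u.im + w.im)]

/-- A relative equilibrium of the vortices `1, 1, m, m` with positive `S_ij` is a kite. -/
theorem kite_of_equilibrium {m : ℝ} (hm : m < 0) {z₁ z₂ z₃ z₄ : ℂ} {S : ℂ → ℂ → ℝ}
    (hS : ∀ a b, S a b = 1 / normSq (a - b) + 1) (h12 : z₁ ≠ z₂) (h13 : z₁ ≠ z₃) (h14 : z₁ ≠ z₄)
    (h23 : z₂ ≠ z₃) (h24 : z₂ ≠ z₄)
    (hnc : ¬ ((z₂ - z₁).re * (z₃ - z₁).im - (z₂ - z₁).im * (z₃ - z₁).re = 0 ∧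
      (z₂ - z₁).re * (z₄ - z₁).im - (z₂ - z₁).im * (z₄ - z₁).re = 0))
    (F₁ : S z₁ z₂ * (z₂ - z₁) + m * S z₁ z₃ * (z₃ - z₁) + m * S z₁ z₄ * (z₄ - z₁) = 0)
    (F₂ : S z₁ z₂ * (z₁ - z₂) + m * S z₂ z₃ * (z₃ - z₂) + m * S z₂ z₄ * (z₄ - z₂) = 0) :
    (normSq (z₁ - z₃) = normSq (z₂ - z₃) ∧ normSq (z₁ - z₄) = normSq (z₂ - z₄)) ∨
    (normSq (z₁ - z₃) = normSq (z₁ - z₄) ∧ normSq (z₂ - z₃) = normSq (z₂ - z₄)) := by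
  have pos : ∀ {a b : ℂ}, a ≠ b → 0 < normSq (a - b) := fun h => normSq_pos.2 (sub_ne_zero.2 h)
  have Spos : ∀ {a b : ℂ}, a ≠ b → S a b ≠ 0 := by
    intro a b h
    rw [hS]
    have := pos h
    positivity
  set T₄ := (z₂ - z₁).re * (z₃ - z₁).im - (z₂ - z₁).im * (z₃ - z₁).re with hT4
  set T₃ := (z₂ - z₁).re * (z₄ - z₁).im - (z₂ - z₁).im * (z₄ - z₁).re with hT3
  set T₂ := (z₃ - z₁).re * (z₄ - z₁).im - (z₃ - z₁).im * (z₄ - z₁).re with hT2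
  set T₁ := (z₃ - z₂).re * (z₄ - z₂).im - (z₃ - z₂).im * (z₄ - z₂).re with hT1
  have r1 := congrArg Complex.re F₁
  have i1 := congrArg Complex.im F₁
  have r2 := congrArg Complex.re F₂
  have i2 := congrArg Complex.im F₂
  simp only [← Complex.ofReal_mul, Complex.add_re, Complex.add_im, Complex.re_ofReal_mul,
    Complex.im_ofReal_mul, Complex.sub_re, Complex.sub_im, Complex.zero_re, Complex.zero_im]
    at r1 i1 r2 i2 hT1 hT2 hT3 hT4
  -- The cross product of a force equation with an edge at its vertex removes one S and relates the
  -- other two through signed areas.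
  have a1 : S z₁ z₃ * T₄ + S z₁ z₄ * T₃ = 0 := by
    apply mul_left_cancel₀ hm.ne
    rw [hT4, hT3]
    linear_combination (z₂.re - z₁.re) * i1 - (z₂.im - z₁.im) * r1
  have a2 : S z₁ z₂ * T₄ - m * S z₁ z₄ * T₂ = 0 := by
    rw [hT4, hT2]
    linear_combination -(z₃.re - z₁.re) * i1 + (z₃.im - z₁.im) * r1
  have a3 : S z₁ z₂ * T₃ + m * S z₁ z₃ * T₂ = 0 := by
    rw [hT3, hT2]
    linear_combination -(z₄.re - z₁.re) * i1 + (z₄.im - z₁.im) * r1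
  have a4 : S z₂ z₃ * T₄ + S z₂ z₄ * T₃ = 0 := by
    apply mul_left_cancel₀ hm.ne
    rw [hT4, hT3]
    linear_combination (z₂.re - z₁.re) * i2 - (z₂.im - z₁.im) * r2
  have a5 : S z₁ z₂ * T₄ + m * S z₂ z₄ * T₁ = 0 := by
    rw [hT4, hT1]
    linear_combination (z₃.re - z₂.re) * i2 - (z₃.im - z₂.im) * r2
  have a6 : S z₁ z₂ * T₃ - m * S z₂ z₃ * T₁ = 0 := by
    rw [hT3, hT1]
    linear_combination (z₄.re - z₂.re) * i2 - (z₄.im - z₂.im) * r2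
  have T4ne : T₄ ≠ 0 := by
    intro h0
    rw [h0, mul_zero, zero_add] at a1
    exact hnc ⟨h0, (mul_eq_zero.1 a1).resolve_left (Spos h14)⟩
  have T2ne : T₂ ≠ 0 := by
    intro h0
    rw [h0, mul_zero, sub_zero] at a2
    exact (mul_ne_zero (Spos h12) T4ne) a2
  have T1ne : T₁ ≠ 0 := by
    intro h0
    rw [h0, mul_zero, add_zero] at a5
    exact (mul_ne_zero (Spos h12) T4ne) a5
  have hm0 := hm.ne
  -- Each d_k is the doubled area of the triangle omitting k, with alternating sign, over Γ_k; σ is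
  -- normalised by S₁₂ = σ d₁ d₂.
  have key := eq_or_eq_of_ptolemy (m := m) (σ := -S z₁ z₂ / (T₁ * T₂)) (d₁ := T₁) (d₂ := -T₂)
    (d₃ := T₃ / m) (d₄ := -T₄ / m) hm0 (pos h13) (pos h14) (pos h23) (pos h24)
    (s₁₂ := normSq (z₁ - z₂)) (s₃₄ := normSq (z₃ - z₄))
    (by
      rw [← hS]; field_simp
      linear_combination a3)
    (by
      rw [← hS]; field_simp
      linear_combination -a2)
    (by
      rw [← hS]; field_simp
      linear_combination -a6)
    (by
      rw [← hS]; field_simp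
      linear_combination a5)
    (by
      simp only [normSq_apply, Complex.sub_re, Complex.sub_im]
      rw [hT1, hT2, hT3, hT4]
      field_simp
      ring)
    (by
      simp only [normSq_apply, Complex.sub_re, Complex.sub_im]
      rw [hT1, hT2, hT3, hT4]
      field_simp
      ring)
    (normSq_mul_normSq_le _ _ _ _)
  have inj : ∀ {a b c d : ℂ}, S a b = S c d → normSq (a - b) = normSq (c - d) := by
    intro a b c d h
    rw [hS, hS, add_left_inj, one_div, one_div, inv_inj] at h
    exact h
  rcases key with h | h
  · refine Or.inl ⟨inj ?_, inj ?_⟩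
    · apply mul_left_cancel₀ (mul_ne_zero hm0 T1ne)
      linear_combination a6 - a3 + m * S z₁ z₃ * h
    · apply mul_left_cancel₀ (mul_ne_zero hm0 T1ne)
      linear_combination a2 - a5 + m * S z₁ z₄ * h
  · have h' : T₃ = -T₄ := by
      field_simp at h
      exact h
    refine Or.inr ⟨inj ?_, inj ?_⟩
    · apply mul_left_cancel₀ T4ne
      linear_combination a1 - S z₁ z₄ * h'
    · apply mul_left_cancel₀ T4ne
      linear_combination a4 - S z₂ z₄ * h'


/-! ### Passage between the Euclidean plane and ℂ -/

/-- The point of the complex plane with the same coordinates. -/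
def toComplex (p : Plane) : ℂ := ⟨p 0, p 1⟩

theorem dist_sq_eq_normSq (p q : Plane) : dist p q ^ 2 = normSq (toComplex p - toComplex q) := by
  rw [EuclideanSpace.dist_sq_eq, Fin.sum_univ_two, Real.dist_eq, Real.dist_eq, sq_abs, sq_abs]
  simp only [toComplex, normSq_apply, Complex.sub_re, Complex.sub_im]
  ring

theorem toComplex_injective : Function.Injective toComplex := by
  intro p q h
  have h0 := congrArg Complex.re h
  have h1 := congrArg Complex.im h
  ext i
  fin_cases i
  · exact h0
  · exact h1

/-- The force `∑ k, Γ k * S i k * (z k - z i)` on the vortex `i`. -/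
noncomputable def force {n : ℕ} (Γ : Fin n → ℝ) (lam : ℝ) (x : Fin n → Plane) (i : Fin n) : ℂ :=
  ∑ k, ((Γ k * S lam x i k : ℝ) : ℂ) * (toComplex (x k) - toComplex (x i))

/-- By polarisation r_jk² - r_ik² - r_ij² is twice the inner product of z_k - z_i and z_i - z_j. -/
theorem albouyChenciner_eq {n : ℕ} (Γ : Fin n → ℝ) (lam : ℝ) (x : Fin n → Plane) (i j : Fin n) :
    albouyChenciner Γ lam x i j = 2 * ((force Γ lam x i - force Γ lam x j) *
      conj (toComplex (x i) - toComplex (x j))).re := by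
  unfold albouyChenciner force
  rw [← Finset.sum_sub_distrib, Finset.sum_mul, Complex.re_sum, Finset.mul_sum]
  refine Finset.sum_congr rfl fun k _ => ?_
  simp only [dist_sq_eq_normSq, normSq_apply, Complex.mul_re, Complex.sub_re, Complex.sub_im,
    Complex.mul_im, Complex.conj_re, Complex.conj_im, Complex.ofReal_re, Complex.ofReal_im]
  ring

theorem exists_ne_zero_of_not_collinear {n : ℕ} {x : Fin n → Plane}
    (h : ¬ Collinear ℝ (Set.range x)) {a b : Fin n} (hab : x a ≠ x b) :
    ∃ c, (toComplex (x b) - toComplex (x a)).re * (toComplex (x c) - toComplex (x a)).im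
      - (toComplex (x b) - toComplex (x a)).im * (toComplex (x c) - toComplex (x a)).re ≠ 0 := by
  by_contra! hc
  apply h
  rw [collinear_iff_of_mem (Set.mem_range_self a)]
  refine ⟨x b - x a, ?_⟩
  rintro _ ⟨c, rfl⟩
  have h1 := hc c
  simp only [toComplex, Complex.sub_re, Complex.sub_im] at h1
  have hN : (x b 0 - x a 0) ^ 2 + (x b 1 - x a 1) ^ 2 ≠ 0 := by
    intro h0
    apply hab
    have h2 : x b 0 - x a 0 = 0 := by nlinarith [sq_nonneg (x b 1 - x a 1)]
    have h3 : x b 1 - x a 1 = 0 := by nlinarith [sq_nonneg (x b 0 - x a 0)]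
    ext i
    fin_cases i
    · exact (sub_eq_zero.1 h2).symm
    · exact (sub_eq_zero.1 h3).symm
  refine ⟨((x b 0 - x a 0) * (x c 0 - x a 0) + (x b 1 - x a 1) * (x c 1 - x a 1)) /
    ((x b 0 - x a 0) ^ 2 + (x b 1 - x a 1) ^ 2), ?_⟩
  ext i
  fin_cases i
  · simp
    field_simp
    linear_combination -(x b 1 - x a 1) * h1
  · simp
    field_simp
    linear_combination (x b 0 - x a 0) * h1

/-- If `p ≠ q` are both equidistant from `a` and `b`, the line through them is an axis of symmetry
of `a` and `b`. -/
theorem reflection_eq_of_dist_eq {p q a b : Plane} (hpq : p ≠ q) (hab : a ≠ b)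
    (hp : dist a p ^ 2 = dist b p ^ 2) (hq : dist a q ^ 2 = dist b q ^ 2) :
    EuclideanGeometry.reflection line[ℝ, p, q] a = b := by
  have pos : ∀ {u v : Plane}, u ≠ v → (v 0 - u 0) ^ 2 + (v 1 - u 1) ^ 2 ≠ 0 := by
    intro u v huv
    have h := normSq_pos.2 (sub_ne_zero.2 (toComplex_injective.ne huv.symm))
    simp only [normSq_apply, toComplex, Complex.sub_re, Complex.sub_im] at h
    nlinarith
  have hN := pos hpq
  have hM := pos hab
  rw [EuclideanSpace.dist_sq_eq, EuclideanSpace.dist_sq_eq, Fin.sum_univ_two, Fin.sum_univ_two]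
    at hp hq
  simp only [Real.dist_eq, sq_abs] at hp hq
  -- Both p - q and the vector from p to the midpoint of a, b are orthogonal to a - b ≠ 0, hence
  -- parallel.
  have hcross : ((a 0 + b 0) / 2 - p 0) * (q 1 - p 1)
      - ((a 1 + b 1) / 2 - p 1) * (q 0 - p 0) = 0 := by
    apply mul_left_cancel₀ hM
    linear_combination
      ((a 0 - b 0) * (q 1 - p 1) - (a 1 - b 1) * (q 0 - p 0)) * hp / 2 -
      ((a 0 - b 0) * ((a 1 + b 1) / 2 - p 1) - (a 1 - b 1) * ((a 0 + b 0) / 2 - p 0))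
        * (hp - hq) / 2
  have hmem : (2⁻¹ : ℝ) • (a + b) ∈ line[ℝ, p, q] := by
    rw [mem_affineSpan_pair_iff_exists_lineMap_eq]
    refine ⟨(((a 0 + b 0) / 2 - p 0) * (q 0 - p 0) + ((a 1 + b 1) / 2 - p 1) * (q 1 - p 1)) /
      ((q 0 - p 0) ^ 2 + (q 1 - p 1) ^ 2), ?_⟩
    ext i
    fin_cases i
    · simp [AffineMap.lineMap_apply]
      field_simp
      linear_combination -2 * (q 1 - p 1) * hcross
    · simp [AffineMap.lineMap_apply]
      field_simp
      linear_combination 2 * (q 0 - p 0) * hcross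
  have horth : (2⁻¹ : ℝ) • (a - b) ∈ (line[ℝ, p, q]).directionᗮ := by
    rw [direction_affineSpan, vectorSpan_pair_rev, Submodule.mem_orthogonal_singleton_iff_inner_right]
    simp [PiLp.inner_apply, Fin.sum_univ_two]
    linear_combination (hp - hq) / 4
  have h := EuclideanGeometry.reflection_orthogonal_vadd hmem horth
  have e1 : (2⁻¹ : ℝ) • (a - b) +ᵥ (2⁻¹ : ℝ) • (a + b) = a := by
    rw [vadd_eq_add]; module
  have e2 : -((2⁻¹ : ℝ) • (a - b)) +ᵥ (2⁻¹ : ℝ) • (a + b) = b := by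
    rw [vadd_eq_add]; module
  rwa [e1, e2] at h

theorem reflection_left_eq (p q : Plane) :
    EuclideanGeometry.reflection line[ℝ, p, q] p = p :=
  (EuclideanGeometry.reflection_eq_self_iff p).2 (left_mem_affineSpan_pair ℝ p q)

theorem reflection_right_eq (p q : Plane) :
    EuclideanGeometry.reflection line[ℝ, p, q] q = q :=
  (EuclideanGeometry.reflection_eq_self_iff q).2 (right_mem_affineSpan_pair ℝ p q)

theorem S_of_ne {n : ℕ} {lam : ℝ} {x : Fin n → Plane} {i j : Fin n} (h : i ≠ j) :
    S lam x i j = 1 / normSq (toComplex (x i) - toComplex (x j)) + lam := by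
  rw [S, if_neg h, dist_sq_eq_normSq]

/-- Conjugating u/|u|² gives 1/u, and λ' = 1 contributes the linear term conj u that becomes part of
v and γ. -/
theorem conj_inv_add_one_mul {z w : ℂ} (h : z ≠ w) :
    conj (((1 / normSq (z - w) + 1 : ℝ) : ℂ) * (w - z)) = 1 / (w - z) + conj (w - z) := by
  have h1 : w - z ≠ 0 := sub_ne_zero.2 h.symm
  have h2 : conj (w - z) ≠ 0 := (map_ne_zero _).2 h1
  rw [map_mul, Complex.conj_ofReal, show normSq (z - w) = normSq (w - z) by
    rw [← normSq_neg]; ring_nf]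
  push_cast
  rw [Complex.normSq_eq_conj_mul_self]
  field_simp

end PointVortex

/-! ### From the Albouy–Chenciner equations to the axis -/

open PointVortex
theorem mainTheorem9 (m : ℝ) (hm : m < 0) (x : Fin 4 → PointVortex.Plane)
    (hplanar : PointVortex.StrictlyPlanar x)
    (hAC : PointVortex.SolvesAlbouyChenciner ![1, 1, m, m] 1 x) :
    PointVortex.HasLineOfSymmetry ![1, 1, m, m] x := by
  obtain ⟨hinj, hcol⟩ := hplanar
  have hz : ∀ {i j : Fin 4}, i ≠ j → toComplex (x i) ≠ toComplex (x j) := fun h =>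
    toComplex_injective.ne (hinj.ne h)
  set F := force ![1, 1, m, m] 1 x with hFdef
  have hF : ∀ i j, ((F i - F j) * conj (toComplex (x i) - toComplex (x j))).re = 0 := by
    have h0 : ∀ i j, i < j →
        ((F i - F j) * conj (toComplex (x i) - toComplex (x j))).re = 0 := by
      intro i j hij
      have := hAC i j hij
      rw [albouyChenciner_eq] at this
      linarith
    intro i j
    rcases lt_trichotomy i j with h | h | h
    · exact h0 i j h
    · simp [h]
    · rw [show (F i - F j) * conj (toComplex (x i) - toComplex (x j))
        = (F j - F i) * conj (toComplex (x j) - toComplex (x i)) by simp only [map_sub]; ring]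
      exact h0 j i h
  obtain ⟨c, hc⟩ := exists_ne_zero_of_not_collinear hcol (hinj.ne (show (0 : Fin 4) ≠ 1 by decide))
  obtain ⟨ω, hω⟩ := exists_angular_velocity (z := fun i => toComplex (x i)) hF hc
  set z₁ := toComplex (x 0) with hz1
  set z₂ := toComplex (x 1) with hz2
  set z₃ := toComplex (x 2) with hz3
  set z₄ := toComplex (x 3) with hz4
  have h12 : z₁ ≠ z₂ := hz (by decide)
  have h13 : z₁ ≠ z₃ := hz (by decide)
  have h14 : z₁ ≠ z₄ := hz (by decide)
  have h23 : z₂ ≠ z₃ := hz (by decide)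
  have h24 : z₂ ≠ z₄ := hz (by decide)
  have h34 : z₃ ≠ z₄ := hz (by decide)
  let T : ℂ → ℂ → ℝ := fun a b => 1 / normSq (a - b) + 1
  have T_comm : ∀ a b, T a b = T b a := by
    intro a b
    simp only [T]
    rw [← normSq_neg, neg_sub]
  have F0 : F 0 = T z₁ z₂ * (z₂ - z₁) + m * (T z₁ z₃ * (z₃ - z₁)) + m * (T z₁ z₄ * (z₄ - z₁)) := by
    simp [hFdef, force, Fin.sum_univ_four, S_of_ne, T, hz1, hz2, hz3, hz4, mul_assoc]
  have F1 : F 1 = T z₂ z₁ * (z₁ - z₂) + m * (T z₂ z₃ * (z₃ - z₂)) + m * (T z₂ z₄ * (z₄ - z₂)) := by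
    simp [hFdef, force, Fin.sum_univ_four, S_of_ne, T, hz1, hz2, hz3, hz4, mul_assoc]
  have F2 : F 2 = m * (T z₃ z₄ * (z₄ - z₃)) + T z₃ z₁ * (z₁ - z₃) + T z₃ z₂ * (z₂ - z₃) := by
    simp [hFdef, force, Fin.sum_univ_four, S_of_ne, T, hz1, hz2, hz3, hz4, mul_assoc]
    ring
  have F3 : F 3 = m * (T z₄ z₃ * (z₃ - z₄)) + T z₄ z₁ * (z₁ - z₄) + T z₄ z₂ * (z₂ - z₄) := by
    simp [hFdef, force, Fin.sum_univ_four, S_of_ne, T, hz1, hz2, hz3, hz4, mul_assoc]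
    ring
  -- The linear terms of the forces sum to conj(Σ Γ_k z_k) - (2 + 2m) conj z_i; moved to the right,
  -- they give the real part of γ.
  have hself : SelfSimilar m z₁ z₂ z₃ z₄
      (conj (F 0) + I * ω * conj z₁ - conj (z₁ + z₂ + m * (z₃ + z₄))) (2 + 2 * m - I * ω) := by
    have w1 := congrArg conj (hω 1 0)
    have w2 := congrArg conj (hω 2 0)
    have w3 := congrArg conj (hω 3 0)
    have c0 := congrArg conj F0
    have c1 := congrArg conj F1
    have c2 := congrArg conj F2
    have c3 := congrArg conj F3
    simp only [map_add, map_mul conj (m : ℂ), Complex.conj_ofReal, T, conj_inv_add_one_mul h12,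
      conj_inv_add_one_mul h13, conj_inv_add_one_mul h14, conj_inv_add_one_mul h23,
      conj_inv_add_one_mul h24, conj_inv_add_one_mul h34, conj_inv_add_one_mul h12.symm,
      conj_inv_add_one_mul h13.symm, conj_inv_add_one_mul h14.symm, conj_inv_add_one_mul h23.symm,
      conj_inv_add_one_mul h24.symm, conj_inv_add_one_mul h34.symm] at c0 c1 c2 c3
    simp only [map_sub, map_mul, Complex.conj_I, Complex.conj_ofReal] at w1 w2 w3 c0 c1 c2 c3
    simp only [SelfSimilar, map_add, map_mul, Complex.conj_ofReal, div_eq_mul_inv] at *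
    refine ⟨?_, ?_, ?_, ?_⟩
    · linear_combination -c0
    · linear_combination w1 - c1
    · linear_combination w2 - c2
    · linear_combination w3 - c3
  obtain ⟨him, hm1⟩ := hself.im_eq_zero h12 h13 h14 h23 h24 h34 hm (by simp)
  have hω0 : ω = 0 := by simpa using him
  have hFF : ∀ i, F i = F 0 := fun i => by
    have := hω i 0
    rw [hω0] at this
    simpa [sub_eq_zero] using this
  have hM : (2 + 2 * m : ℂ) ≠ 0 := by
    have : 2 + 2 * m ≠ 0 := fun h => hm1 (by linarith)
    exact_mod_cast this
  have hF0 : F 0 = 0 := by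
    apply mul_left_cancel₀ hM
    have hsum : F 0 + F 1 + m * F 2 + m * F 3 = 0 := by
      rw [F0, F1, F2, F3, T_comm z₂ z₁, T_comm z₃ z₁, T_comm z₃ z₂, T_comm z₄ z₁, T_comm z₄ z₂,
        T_comm z₄ z₃]
      ring
    rw [hFF 1, hFF 2, hFF 3] at hsum
    linear_combination hsum
  have hkite := kite_of_equilibrium hm (S := T) (fun _ _ => rfl) h12 h13 h14 h23 h24
    (by
      rintro ⟨k3, k4⟩
      apply hc
      fin_cases c
      · change (z₂ - z₁).re * (z₁ - z₁).im - (z₂ - z₁).im * (z₁ - z₁).re = 0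
        simp
      · change (z₂ - z₁).re * (z₂ - z₁).im - (z₂ - z₁).im * (z₂ - z₁).re = 0
        ring
      · exact k3
      · exact k4)
    (by rw [← hF0, F0]; ring)
    (by rw [← hF0, ← hFF 1, F1, T_comm z₂ z₁]; ring)
  simp only [hz1, hz2, hz3, hz4, ← dist_sq_eq_normSq] at hkite
  rcases hkite with ⟨k1, k2⟩ | ⟨k1, k2⟩
  · have hr := reflection_eq_of_dist_eq (hinj.ne (show (2 : Fin 4) ≠ 3 by decide))
      (hinj.ne (show (0 : Fin 4) ≠ 1 by decide)) k1 k2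
    have hr' := reflection_eq_of_dist_eq (hinj.ne (show (2 : Fin 4) ≠ 3 by decide))
      (hinj.ne (show (1 : Fin 4) ≠ 0 by decide)) k1.symm k2.symm
    refine ⟨x 2, x 3, hinj.ne (by decide), Equiv.swap 0 1, fun i => ?_⟩
    fin_cases i
    · exact ⟨rfl, hr⟩
    · exact ⟨rfl, hr'⟩
    · exact ⟨rfl, reflection_left_eq _ _⟩
    · exact ⟨rfl, reflection_right_eq _ _⟩
  · rw [dist_comm (x 0), dist_comm (x 0)] at k1
    rw [dist_comm (x 1), dist_comm (x 1)] at k2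
    have hr := reflection_eq_of_dist_eq (hinj.ne (show (0 : Fin 4) ≠ 1 by decide))
      (hinj.ne (show (2 : Fin 4) ≠ 3 by decide)) k1 k2
    have hr' := reflection_eq_of_dist_eq (hinj.ne (show (0 : Fin 4) ≠ 1 by decide))
      (hinj.ne (show (3 : Fin 4) ≠ 2 by decide)) k1.symm k2.symm
    refine ⟨x 0, x 1, hinj.ne (by decide), Equiv.swap 2 3, fun i => ?_⟩
    fin_cases i
    · exact ⟨rfl, reflection_left_eq _ _⟩
    · exact ⟨rfl, reflection_right_eq _ _⟩
    · exact ⟨rfl, hr⟩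
    · exact ⟨rfl, hr'⟩
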